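/- All functions below are real-valued on $\mathbb Z^2$; $U^t_i$ is the value at time $t$ and site $i$. A *finitely supported udKdV solution* is a $U$ such that for each $t\in\mathbb Z$ only finitely many $U^t_i$ are nonzero, and for all $t,i\in\mathbb Z$ $$U^{t+1}_i=\min\Big(1-U^t_i,\ \sum_{j<i}(U^t_j-U^{t+1}_j)\Big).$$ The *bilinear udKdV equation* for $T$ is, for all $t,i\in\mathbb Z$, $$T_{i+1}^{t+1}+T_i^{t-1}=\max\big(T_{i+1}^t+T_i^t,\ T_i^{t+1}+T_{i+1}^{t-1}-1\big),$$ and the potential of $T$ is $U^t_i=T^t_{i+1}+T^{t+1}_i-T^t_i-T^{t+1}_{i+1}$. $T$ and $T'$ are *gauge equivalent*, written $T\sim T'$, if $T'^t_i=T^t_i+\alpha i+\beta t+\gamma$ for some $\alpha,\beta,\gamma\in\mathbb R$. For a finitely supported udKdV solution $U$ put $X^t_i=\sum_{j\ge i}(U^{t+1}_j-U^{t-1}_j)$, $\omega_{\max}=\max_iX^t_i$ (which does not depend on $t$), $\kappa_{\max}=\min(1,\omega_{\max})$, $c_{\max}=\max(1,\omega_{\max})$ and $M^t=\{i: X^t_i=\omega_{\max}\}$.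 Suppose that $U$ contains a soliton, i.e. $\max_i(U^t_i+U^t_{i+1})>0$ for some $t$. For $m\in M^t$ put $$\phi_{\max}(t,m)=m-c_{\max}t+\frac1{\kappa_{\max}}\Big(\sum_{j\ge m}U^{t-1}_j-\sum_{j<m}U^t_j\Big).$$ A *bound state eigenfunction* is given by a choice of split points $m^t\in M^t$ for all $t\in\mathbb Z$ such that $\phi_{\max}=\phi_{\max}(t,m^t)$ does not depend on $t$; with $\varphi^t_{\max}=\phi_{\max}+c_{\max}t$ it is $$\bar\Theta^t_i=\begin{cases}\kappa_{\max}(i-\varphi^t_{\max})+\sum_{j\ge i}U^t_j & i<m^t,\\ \sum_{j<i}U^{t-1}_j & i\ge m^t.\end{cases}$$ **Corollary.** (1) Let $U$ be a finitely supported udKdV solution with $\max_i(U^t_i+U^t_{i+1})>0$ for some $t$. Then every $M^t$ is nonempty, and for every time $t_0$ and every $m_0\in M^{t_0}$ there is a bound state eigenfunction with $m^{t_0}=m_0$. For every bound state eigenfunction $\bar\Theta$ the undressed potential $$\widehat U^t_i=U^t_i+(\bar\Theta^t_{i+1}-\bar\Theta^t_i)-(\bar\Theta^{t+1}_{i+1}-\bar\Theta^{t+1}_i)$$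 equals $U^{t+1}_i$ for $i<m^t$ and $U^{t-1}_i$ for $i\ge m^t$, and $\widehat U$ is again a finitely supported udKdV solution. (2) Let $T$ be a solution of the bilinear udKdV equation whose potential $U$ has, at each time, finite support, and satisfies $\max_i(U^t_i+U^t_{i+1})>0$ for some $t$. Then $U$ is a udKdV solution, and for every bound state eigenfunction $\bar\Theta$ of $U$ the function $\widehat T=T+\bar\Theta$ is a solution of the bilinear udKdV equation with potential $\widehat U$. If moreover $T$ is normalised so that for each $t$ one has $T^t_i-T^{t+1}_i=-\tfrac12\sum_jU^t_j$ for all sufficiently large $-i$, then $$T+\bar\Theta\ \sim\ \min\Big(\tfrac12\kappa_{\max}(i-\varphi^t_{\max})+T^{t+1}_i,\ -\tfrac12\kappa_{\max}(i-\varphi^t_{\max})+T^{t-1}_i\Big),$$ and every function gauge equivalent to the right-hand side solves the bilinear udKdV equation. -/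

import Mathlib

open Filter

noncomputable section

namespace UdKdV

/-! Throughout, a field on the space-time lattice is a function `U : ℤ → ℤ → ℝ`, where `U t i`
is the value at time `t` and site `i`. All the (finite) sums over sites are `finsum`s, which are
ordinary sums for summands of finite support. -/

/-- At every time, `U` vanishes at all but finitely many sites. -/
def FinitelySupported (U : ℤ → ℤ → ℝ) : Prop :=
  ∀ t, (Function.support (U t)).Finite

/-- The ultradiscrete KdV equation (update rule), at all times and sites. -/
def IsUdKdV (U : ℤ → ℤ → ℝ) : Prop :=
  ∀ t i, U (t + 1) i = min (1 - U t i) (∑ᶠ j ∈ Set.Iio i, (U t j - U (t + 1) j))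

/-- The bilinear ultradiscrete KdV equation. -/
def IsBilinear (T : ℤ → ℤ → ℝ) : Prop :=
  ∀ t i, T (t + 1) (i + 1) + T (t - 1) i =
    max (T t (i + 1) + T t i) (T (t + 1) i + T (t - 1) (i + 1) - 1)

/-- The field `U` determined by a `T`-function. -/
def potential (T : ℤ → ℤ → ℝ) (t i : ℤ) : ℝ :=
  T t (i + 1) + T (t + 1) i - T t i - T (t + 1) (i + 1)

/-- Gauge equivalence `T' t i = T t i + α i + β t + γ` of `T`-functions. -/
def GaugeEquiv (T T' : ℤ → ℤ → ℝ) : Prop :=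
  ∃ α β γ : ℝ, ∀ t i : ℤ, T' t i = T t i + α * i + β * t + γ

/-- The maximal local sum `V^t = max_i (U^t_i + U^t_{i+1})`. -/
def localMax (U : ℤ → ℤ → ℝ) (t : ℤ) : ℝ :=
  ⨆ i : ℤ, (U t i + U t (i + 1))

/-- The density `X^t_i = ∑_{j ≥ i} (U^{t+1}_j - U^{t-1}_j)`. -/
def X (U : ℤ → ℤ → ℝ) (t i : ℤ) : ℝ :=
  ∑ᶠ j ∈ Set.Ici i, (U (t + 1) j - U (t - 1) j)

/-- The maximal soliton mass `ω_max = max_i X^t_i`. -/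
def omegaMax (U : ℤ → ℤ → ℝ) (t : ℤ) : ℝ :=
  ⨆ i : ℤ, X U t i

/-- `κ_max = min (1, ω_max)`. -/
def kappaMax (U : ℤ → ℤ → ℝ) (t : ℤ) : ℝ :=
  min 1 (omegaMax U t)

/-- The maximal soliton speed `c_max = max (1, ω_max)`. -/
def cMax (U : ℤ → ℤ → ℝ) (t : ℤ) : ℝ :=
  max 1 (omegaMax U t)

/-- The set `M^t` of sites at which `X^t` attains its maximum. -/
def maxSites (U : ℤ → ℤ → ℝ) (t : ℤ) : Set ℤ :=
  {i | X U t i = omegaMax U t}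

/-- The phase constant `φ_max` calculated at time `t` from the split point `m`. -/
def phiMax (U : ℤ → ℤ → ℝ) (t m : ℤ) : ℝ :=
  m - cMax U t * t +
    1 / kappaMax U t * ((∑ᶠ j ∈ Set.Ici m, U (t - 1) j) - ∑ᶠ j ∈ Set.Iio m, U t j)

/-- The time-dependent phase `φ^t_max = φ_max + c_max t`. -/
def varphiMax (U : ℤ → ℤ → ℝ) (t m : ℤ) : ℝ :=
  phiMax U t m + cMax U t * t

/-- A choice, for every time `t`, of a split point `m t` in `M^t`, such that the phase constant
`φ_max` is the same at all times. Such a choice specifies one bound state eigenfunction. -/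
def IsSplitFamily (U : ℤ → ℤ → ℝ) (m : ℤ → ℤ) : Prop :=
  (∀ t, m t ∈ maxSites U t) ∧ ∀ s t, phiMax U s (m s) = phiMax U t (m t)

/-- The bound state eigenfunction with split points `m t`. -/
def boundState (U : ℤ → ℤ → ℝ) (m : ℤ → ℤ) (t i : ℤ) : ℝ :=
  if i < m t then
    kappaMax U t * (i - varphiMax U t (m t)) + ∑ᶠ j ∈ Set.Ici i, U t j
  else
    ∑ᶠ j ∈ Set.Iio i, U (t - 1) j

/-- The Darboux transformation of a potential `U` by an eigenfunction `Θ`. -/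
def darboux (U Θ : ℤ → ℤ → ℝ) (t i : ℤ) : ℝ :=
  U t i + (Θ t (i + 1) - Θ t i) - (Θ (t + 1) (i + 1) - Θ (t + 1) i)

/-- The undressing transformation of a potential: the Darboux transformation by a bound state. -/
def undress (U : ℤ → ℤ → ℝ) (m : ℤ → ℤ) : ℤ → ℤ → ℝ :=
  darboux U (boundState U m)

/-- The undressing transformation of a `T`-function, in the form of a minimum of two terms. -/
def undressT (T : ℤ → ℤ → ℝ) (m : ℤ → ℤ) (t i : ℤ) : ℝ :=
  min (1 / 2 * kappaMax (potential T) t * (i - varphiMax (potential T) t (m t)) + T (t + 1) i)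
    (-(1 / 2) * kappaMax (potential T) t * (i - varphiMax (potential T) t (m t)) + T (t - 1) i)

/-- The normalisation `Z_- = -½ ∑_j U^t_j` at `i → -∞` of the discrete potential
`Z^t_i = T^t_i - T^{t+1}_i`. -/
def IsNormalised (T : ℤ → ℤ → ℝ) : Prop :=
  ∀ t, ∀ᶠ i in atBot, T t i - T (t + 1) i = -(1 / 2) * ∑ᶠ j, potential T t j

end UdKdV

end

noncomputable section

namespace UdKdV

/-! ### Partial sums of finitely supported functions -/

/-- The sum of `f` over all sites strictly to the left of `i`. -/
def leftSum (f : ℤ → ℝ) (i : ℤ) : ℝ := ∑ᶠ j ∈ Set.Iio i, f j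

theorem leftSum_succ {f : ℤ → ℝ} (hf : f.support.Finite) (i : ℤ) :
    leftSum f (i + 1) = leftSum f i + f i := by
  have h : Set.Iio (i + 1) = insert i (Set.Iio i) := by
    ext j; simp only [Set.mem_Iio, Set.mem_insert_iff]; omega
  rw [leftSum, h, finsum_mem_insert' f (by simp) (hf.subset Set.inter_subset_right), leftSum,
    add_comm]

theorem eventually_atBot_eq_zero {f : ℤ → ℝ} (hf : f.support.Finite) :
    ∃ a, ∀ i < a, f i = 0 := by
  obtain ⟨a, ha⟩ := hf.bddBelow
  refine ⟨a, fun i hi => ?_⟩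
  by_contra h
  exact absurd (ha h) (not_le.mpr hi)

theorem eventually_atTop_eq_zero {f : ℤ → ℝ} (hf : f.support.Finite) :
    ∃ a, ∀ i ≥ a, f i = 0 := by
  obtain ⟨a, ha⟩ := hf.bddAbove
  refine ⟨a + 1, fun i hi => ?_⟩
  by_contra h
  have : i ≤ a := ha h
  omega

theorem leftSum_atBot {f : ℤ → ℝ} (hf : f.support.Finite) : ∃ a, ∀ i ≤ a, leftSum f i = 0 := by
  obtain ⟨a, ha⟩ := eventually_atBot_eq_zero hf
  refine ⟨a, fun i hi => finsum_mem_eq_zero_of_forall_eq_zero fun j hj => ha j ?_⟩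
  exact lt_of_lt_of_le hj hi

theorem rightSum_eq {f : ℤ → ℝ} (hf : f.support.Finite) (i : ℤ) :
    ∑ᶠ j ∈ Set.Ici i, f j = ∑ᶠ j, f j - leftSum f i := by
  have h := finsum_mem_union' (f := f) (s := Set.Iio i) (t := Set.Ici i)
    (Set.disjoint_left.mpr fun j hj hj' => absurd (Set.mem_Iio.mp hj) (not_lt.mpr (Set.mem_Ici.mp hj')))
    (hf.subset Set.inter_subset_right) (hf.subset Set.inter_subset_right)
  rw [Set.Iio_union_Ici, finsum_mem_univ] at h
  rw [h, leftSum]; ring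

theorem leftSum_atTop {f : ℤ → ℝ} (hf : f.support.Finite) :
    ∃ a, ∀ i ≥ a, leftSum f i = ∑ᶠ j, f j := by
  obtain ⟨a, ha⟩ := eventually_atTop_eq_zero hf
  refine ⟨a, fun i hi => ?_⟩
  have h := rightSum_eq hf i
  have h0 : ∑ᶠ j ∈ Set.Ici i, f j = 0 :=
    finsum_mem_eq_zero_of_forall_eq_zero fun j hj => ha j (le_trans hi (Set.mem_Ici.mp hj))
  linarith

theorem support_sub_finite {f g : ℤ → ℝ} (hf : f.support.Finite) (hg : g.support.Finite) :
    (Function.support fun j => f j - g j).Finite :=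
  (hf.union hg).subset (Function.support_sub f g)

/-- Two functions on `ℤ` with equal increments which agree far to the left are equal. -/
theorem eq_of_increments_eq {P Q : ℤ → ℝ} (h : ∀ i, P (i + 1) - P i = Q (i + 1) - Q i)
    {a : ℤ} (ha : ∀ i ≤ a, P i = Q i) (i : ℤ) : P i = Q i := by
  rcases le_total i a with hi | hi
  · exact ha i hi
  · induction i, hi using Int.leInduction with
    | base => exact ha a le_rfl
    | succ n _ ih => linarith [h n]

theorem leftSum_eq_of_increments {f P : ℤ → ℝ} (hf : f.support.Finite)
    (h : ∀ i, P (i + 1) = P i + f i) {a : ℤ} (ha : ∀ i ≤ a, P i = 0) (i : ℤ) :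
    leftSum f i = P i := by
  obtain ⟨b, hb⟩ := leftSum_atBot hf
  refine eq_of_increments_eq (a := min a b) (fun i => ?_) (fun i hi => ?_) i
  · rw [leftSum_succ hf, h]; ring
  · rw [hb i (hi.trans (min_le_right a b)), ha i (hi.trans (min_le_left a b))]

theorem leftSum_sub {f g : ℤ → ℝ} (hf : f.support.Finite) (hg : g.support.Finite) (i : ℤ) :
    ∑ᶠ j ∈ Set.Iio i, (f j - g j) = leftSum f i - leftSum g i := by
  obtain ⟨a, ha⟩ := leftSum_atBot hf
  obtain ⟨b, hb⟩ := leftSum_atBot hg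
  refine leftSum_eq_of_increments (f := fun j => f j - g j)
    (P := fun i => leftSum f i - leftSum g i) (a := min a b)
    (support_sub_finite hf hg) (fun i => ?_) (fun i hi => ?_) i
  · simp only [leftSum_succ hf, leftSum_succ hg]; ring
  · simp only [ha i (hi.trans (min_le_left a b)), hb i (hi.trans (min_le_right a b)), sub_self]

/-! ### The local form of the udKdV equation -/

/-- The udKdV equation for a field `U` with cumulative sums `S` and total mass `N`, in a form
that is symmetric under reversal of space-time. -/
structure LocalSol (U S : ℤ → ℤ → ℝ) (N : ℝ) : Prop where
  succ : ∀ t i, S t (i + 1) = S t i + U t i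
  bot : ∀ t, ∃ a, ∀ i ≤ a, S t i = 0
  top : ∀ t, ∃ a, ∀ i ≥ a, S t i = N
  le_one : ∀ t i, U t i + U (t + 1) i ≤ 1
  le_carrier : ∀ t i, U (t + 1) i ≤ S t i - S (t + 1) i
  eq_or : ∀ t i, U t i + U (t + 1) i = 1 ∨ U (t + 1) i = S t i - S (t + 1) i

theorem min_eq_iff_le_or {x a b : ℝ} : x = min a b ↔ x ≤ a ∧ x ≤ b ∧ (x = a ∨ x = b) := by
  constructor
  · rintro rfl
    exact ⟨min_le_left a b, min_le_right a b, min_choice a b⟩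
  · rintro ⟨h1, h2, h | h⟩
    · rw [min_eq_left (h ▸ h2), h]
    · rw [min_eq_right (h ▸ h1), h]

theorem isUdKdV_iff {U : ℤ → ℤ → ℝ} (hF : FinitelySupported U) :
    IsUdKdV U ↔ ∀ t i, U (t + 1) i =
      min (1 - U t i) (leftSum (U t) i - leftSum (U (t + 1)) i) := by
  refine forall₂_congr fun t i => ?_
  rw [leftSum_sub (hF t) (hF (t + 1))]

theorem mass_conserved {U : ℤ → ℤ → ℝ} (hF : FinitelySupported U) (hK : IsUdKdV U) (t : ℤ) :
    ∑ᶠ j, U t j = ∑ᶠ j, U 0 j := by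
  have step : ∀ t, ∑ᶠ j, U (t + 1) j = ∑ᶠ j, U t j := by
    intro t
    obtain ⟨a, ha⟩ := leftSum_atTop (hF t)
    obtain ⟨b, hb⟩ := leftSum_atTop (hF (t + 1))
    obtain ⟨c, hc⟩ := eventually_atTop_eq_zero (hF t)
    obtain ⟨d, hd⟩ := eventually_atTop_eq_zero (hF (t + 1))
    obtain ⟨i, hi⟩ : ∃ i, max (max a b) (max c d) ≤ i := ⟨_, le_rfl⟩
    simp only [max_le_iff] at hi
    have h := (isUdKdV_iff hF).mp hK t i
    rw [ha i hi.1.1, hb i hi.1.2, hc i hi.2.1, hd i hi.2.2, min_eq_iff_le_or] at h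
    rcases h with ⟨-, -, h | h⟩ <;> linarith
  induction t using Int.induction_on with
  | zero => rfl
  | succ n ih => rw [step, ih]
  | pred n ih => rw [← ih, ← step, sub_add_cancel]

theorem localSol_of_isUdKdV {U : ℤ → ℤ → ℝ} (hF : FinitelySupported U) (hK : IsUdKdV U) :
    LocalSol U (fun t => leftSum (U t)) (∑ᶠ j, U 0 j) := by
  have h := fun t i => min_eq_iff_le_or.mp ((isUdKdV_iff hF).mp hK t i)
  refine ⟨fun t i => leftSum_succ (hF t) i, fun t => leftSum_atBot (hF t), fun t => ?_,
    fun t i => ?_, fun t i => (h t i).2.1, fun t i => ?_⟩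
  · obtain ⟨a, ha⟩ := leftSum_atTop (hF t)
    exact ⟨a, fun i hi => by rw [ha i hi, mass_conserved hF hK]⟩
  · linarith [(h t i).1]
  · rcases (h t i).2.2 with h | h
    · left; linarith
    · right; exact h

namespace LocalSol

variable {U S : ℤ → ℤ → ℝ} {N : ℝ}

theorem le_carrier_succ (h : LocalSol U S N) (t i : ℤ) :
    U t i ≤ S t (i + 1) - S (t + 1) (i + 1) := by
  linarith [h.succ t i, h.succ (t + 1) i, h.le_carrier t i]

theorem pred (h : LocalSol U S N) (t i : ℤ) : U (t - 1) i + U t i ≤ 1 ∧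
    U t i ≤ S (t - 1) i - S t i ∧
    (U (t - 1) i + U t i = 1 ∨ U t i = S (t - 1) i - S t i) := by
  have h1 := h.le_one (t - 1) i
  have h2 := h.le_carrier (t - 1) i
  have h3 := h.eq_or (t - 1) i
  rw [sub_add_cancel] at h1 h2 h3
  exact ⟨h1, h2, h3⟩

theorem density_le_succ (h : LocalSol U S N) {t i : ℤ}
    (hX : S (t - 1) (i + 1) - S (t + 1) (i + 1) < S (t - 1) i - S (t + 1) i) :
    S (t - 1) i - S (t + 1) i ≤ S t (i + 1) - S (t + 2) (i + 1) := by
  have e1 := h.succ (t - 1) i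
  have e2 := h.succ t i
  have e3 := h.succ (t + 1) i
  have e4 := h.le_one t i
  have e5 := h.le_carrier_succ (t + 1) i
  rw [add_assoc, one_add_one_eq_two] at e5
  rcases (h.pred t i).2.2 with e | e <;> linarith

theorem density_le_pred (h : LocalSol U S N) {t i : ℤ}
    (hX : S (t - 1) i - S (t + 1) i < S (t - 1) (i + 1) - S (t + 1) (i + 1)) :
    S (t - 1) (i + 1) - S (t + 1) (i + 1) ≤ S (t - 2) i - S t i := by
  have e1 := h.succ (t - 1) i
  have e2 := h.succ t i
  have e3 := h.succ (t + 1) i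
  have e4 := (h.pred t i).1
  have e5 := (h.pred (t - 1) i).2.1
  rw [sub_sub, one_add_one_eq_two] at e5
  rcases h.eq_or t i with e | e <;> linarith

theorem sum_le_density (h : LocalSol U S N) (t i : ℤ) :
    U t i + U (t + 1) i ≤ S (t - 1) i - S (t + 1) i := by
  linarith [h.le_carrier t i, (h.pred t i).2.1]

theorem density_atTop (h : LocalSol U S N) (t : ℤ) :
    ∃ a, ∀ i ≥ a, S (t - 1) i - S (t + 1) i = 0 := by
  obtain ⟨a, ha⟩ := h.top (t - 1)
  obtain ⟨b, hb⟩ := h.top (t + 1)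
  refine ⟨max a b, fun i hi => ?_⟩
  rw [ha i (le_trans (le_max_left a b) hi), hb i (le_trans (le_max_right a b) hi), sub_self]

theorem density_atBot (h : LocalSol U S N) (t : ℤ) :
    ∃ a, ∀ i ≤ a, S (t - 1) i - S (t + 1) i = 0 := by
  obtain ⟨a, ha⟩ := h.bot (t - 1)
  obtain ⟨b, hb⟩ := h.bot (t + 1)
  refine ⟨min a b, fun i hi => ?_⟩
  rw [ha i (le_trans hi (min_le_left a b)), hb i (le_trans hi (min_le_right a b)), sub_self]

/-- Walking to the right inside the set where the density equals `ω ≠ 0`, one arrives at a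
last site. -/
theorem exists_right_end (h : LocalSol U S N) {ω : ℝ} (hω : ω ≠ 0) {t : ℤ} {p : ℤ → Prop} {m : ℤ}
    (hm : S (t - 1) m - S (t + 1) m = ω) (hp : p m)
    (hs : ∀ i, p i → S (t - 1) i - S (t + 1) i = ω →
      S (t - 1) (i + 1) - S (t + 1) (i + 1) = ω → p (i + 1)) :
    ∃ r, p r ∧ S (t - 1) r - S (t + 1) r = ω ∧
      S (t - 1) (r + 1) - S (t + 1) (r + 1) ≠ ω := by
  by_contra! hc
  have key : ∀ i, m ≤ i → p i ∧ S (t - 1) i - S (t + 1) i = ω := by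
    intro i hi
    induction i, hi using Int.leInduction with
    | base => exact ⟨hp, hm⟩
    | succ n _ ih => exact ⟨hs n ih.1 ih.2 (hc n ih.1 ih.2), hc n ih.1 ih.2⟩
  obtain ⟨a, ha⟩ := h.density_atTop t
  exact hω ((key (max a m) (le_max_right a m)).2 ▸ ha (max a m) (le_max_left a m))

/-- Walking to the left inside the set where the density equals `ω ≠ 0`, one arrives at a
first site. -/
theorem exists_left_end (h : LocalSol U S N) {ω : ℝ} (hω : ω ≠ 0) {t : ℤ} {p : ℤ → Prop} {m : ℤ}
    (hm : S (t - 1) m - S (t + 1) m = ω) (hp : p m)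
    (hs : ∀ i, p (i + 1) → S (t - 1) (i + 1) - S (t + 1) (i + 1) = ω →
      S (t - 1) i - S (t + 1) i = ω → p i) :
    ∃ l, p (l + 1) ∧ S (t - 1) (l + 1) - S (t + 1) (l + 1) = ω ∧
      S (t - 1) l - S (t + 1) l ≠ ω := by
  by_contra! hc
  have key : ∀ i, i ≤ m → p i ∧ S (t - 1) i - S (t + 1) i = ω := by
    intro i hi
    induction i, hi using Int.leInductionDown with
    | base => exact ⟨hp, hm⟩
    | pred n _ ih =>
      have := hc (n - 1)
      have hs' := hs (n - 1)
      rw [sub_add_cancel] at this hs'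
      exact ⟨hs' ih.1 ih.2 (this ih.1 ih.2), this ih.1 ih.2⟩
  obtain ⟨a, ha⟩ := h.density_atBot t
  exact hω ((key (min a m) (min_le_right a m)).2 ▸ ha (min a m) (min_le_left a m))

theorem exists_max_density (h : LocalSol U S N) (t : ℤ) :
    ∃ m, 0 ≤ S (t - 1) m - S (t + 1) m ∧
      ∀ i, S (t - 1) i - S (t + 1) i ≤ S (t - 1) m - S (t + 1) m := by
  obtain ⟨a, ha⟩ := h.density_atBot t
  obtain ⟨b, hb⟩ := h.density_atTop t
  obtain ⟨m, -, hm⟩ := (Finset.Icc (min a b) b).exists_max_image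
    (fun i => S (t - 1) i - S (t + 1) i) ⟨b, by simp⟩
  have h0 : 0 ≤ S (t - 1) m - S (t + 1) m := by
    simpa [hb b le_rfl] using hm b (by simp)
  refine ⟨m, h0, fun i => ?_⟩
  rcases lt_or_ge i (min a b) with hi | hi
  · rw [ha i (hi.le.trans (min_le_left a b))]; exact h0
  · rcases le_total i b with hi' | hi'
    · exact hm i (Finset.mem_Icc.mpr ⟨hi, hi'⟩)
    · rw [hb i hi']; exact h0

theorem density_bound_succ (h : LocalSol U S N) {t : ℤ} {ω : ℝ}
    (hω : ∀ i, S t i - S (t + 2) i ≤ ω) (i : ℤ) : S (t - 1) i - S (t + 1) i ≤ ω := by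
  obtain ⟨m, h0, hm⟩ := h.exists_max_density t
  refine (hm i).trans ?_
  rcases h0.eq_or_lt with h0 | h0
  · obtain ⟨a, ha⟩ := h.density_atTop (t + 1)
    have e := ha a le_rfl
    rw [add_sub_cancel_right, add_assoc, one_add_one_eq_two] at e
    linarith [hω a]
  · obtain ⟨r, -, hr, hr'⟩ := h.exists_right_end h0.ne' (p := fun _ => True) rfl trivial
      (fun _ _ _ _ => trivial)
    have e := h.density_le_succ (lt_of_le_of_ne ((hm (r + 1)).trans hr.ge) (hr ▸ hr'))
    linarith [hω (r + 1)]

theorem density_bound_pred (h : LocalSol U S N) {t : ℤ} {ω : ℝ}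
    (hω : ∀ i, S (t - 2) i - S t i ≤ ω) (i : ℤ) : S (t - 1) i - S (t + 1) i ≤ ω := by
  obtain ⟨m, h0, hm⟩ := h.exists_max_density t
  refine (hm i).trans ?_
  rcases h0.eq_or_lt with h0 | h0
  · obtain ⟨a, ha⟩ := h.density_atTop (t - 1)
    have e := ha a le_rfl
    rw [sub_add_cancel, sub_sub, one_add_one_eq_two] at e
    linarith [hω a]
  · obtain ⟨l, -, hl, hl'⟩ := h.exists_left_end h0.ne' (p := fun _ => True) rfl trivial
      (fun _ _ _ _ => trivial)
    have e := h.density_le_pred (lt_of_le_of_ne ((hm l).trans hl.ge) (hl ▸ hl'))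
    linarith [hω l]

theorem density_bound (h : LocalSol U S N) {t₀ : ℤ} {ω : ℝ}
    (hω : ∀ i, S (t₀ - 1) i - S (t₀ + 1) i ≤ ω) (t i : ℤ) : S (t - 1) i - S (t + 1) i ≤ ω := by
  revert i
  rcases le_total t t₀ with ht | ht
  · induction t, ht using Int.leInductionDown with
    | base => exact hω
    | pred n _ ih =>
      refine h.density_bound_succ (t := n - 1) fun i => ?_
      convert ih i using 3
      ring
  · induction t, ht using Int.leInduction with
    | base => exact hω
    | succ n _ ih =>
      refine h.density_bound_pred (t := n + 1) fun i => ?_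
      convert ih i using 3
      ring

end LocalSol

/-! ### Phases -/

/-- A solution of the udKdV equation together with its maximal soliton mass `ω`. -/
structure MaxSol (U S : ℤ → ℤ → ℝ) (N ω : ℝ) : Prop extends LocalSol U S N where
  pos : 0 < ω
  density_le : ∀ t i, S (t - 1) i - S (t + 1) i ≤ ω

/-- The phase function, which equals `κ_max φ_max` at the split points. -/
def phase (S : ℤ → ℤ → ℝ) (N ω : ℝ) (t i : ℤ) : ℝ :=
  min 1 ω * i - S t i - S (t - 1) i + N - ω * t

theorem phase_time_succ (S : ℤ → ℤ → ℝ) (N ω : ℝ) (t i : ℤ) :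
    phase S N ω (t + 1) i = phase S N ω t i + (S (t - 1) i - S (t + 1) i) - ω := by
  simp only [phase, add_sub_cancel_right]; push_cast; ring

namespace MaxSol

variable {U S : ℤ → ℤ → ℝ} {N ω : ℝ}

theorem kappa_pos (h : MaxSol U S N ω) : 0 < min 1 ω := lt_min one_pos h.pos

theorem sum_le_kappa (h : MaxSol U S N ω) (t i : ℤ) : U t i + U (t + 1) i ≤ min 1 ω :=
  le_min (h.le_one t i) ((h.sum_le_density t i).trans (h.density_le t i))

theorem phase_succ (h : MaxSol U S N ω) (t i : ℤ) :
    phase S N ω t (i + 1) = phase S N ω t i + (min 1 ω - (U (t - 1) i + U t i)) := by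
  simp only [phase, h.succ]; push_cast; ring

theorem phase_mono (h : MaxSol U S N ω) (t : ℤ) : Monotone (phase S N ω t) := by
  refine monotone_int_of_le_succ fun i => ?_
  have := h.sum_le_kappa (t - 1) i
  rw [sub_add_cancel] at this
  linarith [h.phase_succ t i]

theorem sum_eq_kappa (h : MaxSol U S N ω) {t m : ℤ} (hm : S (t - 1) m - S (t + 1) m = ω) :
    U t m + U (t + 1) m = min 1 ω := by
  refine le_antisymm (h.sum_le_kappa t m) ?_
  rcases h.eq_or t m with e | e
  · rw [e]; exact min_le_left 1 ω
  · have e1 := h.succ (t - 1) m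
    have e2 := h.succ (t + 1) m
    have e3 := h.density_le t (m + 1)
    rcases (h.pred t m).2.2 with e' | e'
    · exact (min_le_left 1 ω).trans (by linarith)
    · exact (min_le_right 1 ω).trans (by linarith)

theorem sum_eq_kappa_left (h : MaxSol U S N ω) {t m : ℤ}
    (hm : S (t - 1) (m + 1) - S (t + 1) (m + 1) = ω) : U (t - 1) m + U t m = min 1 ω := by
  have hle := h.sum_le_kappa (t - 1) m
  rw [sub_add_cancel] at hle
  refine le_antisymm hle ?_
  have e1 := h.succ (t - 1) m
  have e2 := h.succ (t + 1) m
  have e5 := h.succ t m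
  have e3 := h.density_le t m
  rcases (h.pred t m).2.2 with e | e
  · rw [e]; exact min_le_left 1 ω
  · rcases h.eq_or t m with e' | e'
    · exact (min_le_left 1 ω).trans (by linarith)
    · exact (min_le_right 1 ω).trans (by linarith)

theorem exists_succ_site (h : MaxSol U S N ω) {t m : ℤ} (hm : S (t - 1) m - S (t + 1) m = ω) :
    ∃ r, S (t - 1) r - S (t + 1) r = ω ∧ phase S N ω t r = phase S N ω t m ∧
      S t (r + 1) - S (t + 2) (r + 1) = ω ∧
      phase S N ω (t + 1) (r + 1) = phase S N ω t m := by
  obtain ⟨r, hr1, hr2, hr3⟩ := h.exists_right_end h.pos.ne'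
    (p := fun i => phase S N ω t i = phase S N ω t m) hm rfl (fun i hi h1 h2 => by
      have e := h.phase_succ (t + 1) i
      rw [phase_time_succ, phase_time_succ, add_sub_cancel_right, h.sum_eq_kappa h1] at e
      linarith)
  refine ⟨r, hr2, hr1, le_antisymm ?_ ?_, ?_⟩
  · have := h.density_le (t + 1) (r + 1)
    rwa [add_sub_cancel_right, add_assoc, one_add_one_eq_two] at this
  · have := h.density_le_succ (lt_of_le_of_ne ((h.density_le t (r + 1)).trans hr2.ge)
      (hr2 ▸ hr3))
    linarith
  · have e := h.phase_succ (t + 1) r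
    rw [phase_time_succ S N ω t r, add_sub_cancel_right, h.sum_eq_kappa hr2] at e
    linarith

theorem exists_pred_site (h : MaxSol U S N ω) {t m : ℤ} (hm : S (t - 1) m - S (t + 1) m = ω) :
    ∃ l, S (t - 2) l - S t l = ω ∧ phase S N ω (t - 1) l = phase S N ω t m := by
  obtain ⟨l, hl1, hl2, hl3⟩ := h.exists_left_end h.pos.ne'
    (p := fun i => phase S N ω t i = phase S N ω t m) hm rfl (fun i hi h1 h2 => by
      have e := h.phase_succ t i
      rw [h.sum_eq_kappa_left h1] at e
      linarith)
  have hl : S (t - 2) l - S t l = ω := by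
    refine le_antisymm ?_ ?_
    · have := h.density_le (t - 1) l
      rwa [sub_add_cancel, sub_sub, one_add_one_eq_two] at this
    · have := h.density_le_pred (lt_of_le_of_ne ((h.density_le t l).trans hl2.ge)
        (hl2 ▸ hl3))
      linarith
  refine ⟨l, hl, ?_⟩
  have e := h.phase_succ t l
  have e' := phase_time_succ S N ω (t - 1) l
  rw [sub_add_cancel, sub_sub, one_add_one_eq_two] at e'
  rw [h.sum_eq_kappa_left hl2] at e
  linarith

/-- Every maximal site extends to a family of maximal sites of constant phase. -/
theorem exists_family (h : MaxSol U S N ω) {t₀ m₀ : ℤ}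
    (hm : S (t₀ - 1) m₀ - S (t₀ + 1) m₀ = ω) :
    ∃ m : ℤ → ℤ, m t₀ = m₀ ∧ ∀ t, S (t - 1) (m t) - S (t + 1) (m t) = ω ∧
      phase S N ω t (m t) = phase S N ω t₀ m₀ := by
  have key : ∀ t, ∃ m, S (t - 1) m - S (t + 1) m = ω ∧
      phase S N ω t m = phase S N ω t₀ m₀ := by
    intro t
    rcases le_total t t₀ with ht | ht
    · induction t, ht using Int.leInductionDown with
      | base => exact ⟨m₀, hm, rfl⟩
      | pred n _ ih =>
        obtain ⟨m, h1, h2⟩ := ih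
        obtain ⟨l, h3, h4⟩ := h.exists_pred_site h1
        exact ⟨l, by rwa [sub_add_cancel, sub_sub, one_add_one_eq_two], h4.trans h2⟩
    · induction t, ht using Int.leInduction with
      | base => exact ⟨m₀, hm, rfl⟩
      | succ n _ ih =>
        obtain ⟨m, h1, h2⟩ := ih
        obtain ⟨r, -, -, h3, h4⟩ := h.exists_succ_site h1
        exact ⟨r + 1, by rwa [add_sub_cancel_right, add_assoc, one_add_one_eq_two],
          h4.trans h2⟩
  choose m hm1 hm2 using key
  refine ⟨Function.update m t₀ m₀, by simp, fun t => ?_⟩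
  rcases eq_or_ne t t₀ with rfl | ht
  · simp [hm]
  · rw [Function.update_of_ne ht]
    exact ⟨hm1 t, hm2 t⟩

/-- Between a maximal site and a later site of equal phase at the same time, the fields at the two adjacent times
coincide. -/
theorem eq_of_between (h : MaxSol U S N ω) {t m n : ℤ} (hm : S (t - 1) m - S (t + 1) m = ω)
    (hp : phase S N ω t m = phase S N ω t n) {i : ℤ} (hmi : m ≤ i) (hin : i < n) : U (t + 1) i = U (t - 1) i := by
  have key : ∀ j, m ≤ j → j ≤ n → S (t - 1) j - S (t + 1) j = ω := by
    intro j h1 h2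
    have a1 := h.phase_mono t h2
    have a2 := h.phase_mono (t + 1) h1
    rw [phase_time_succ, phase_time_succ] at a2
    linarith [h.density_le t j]
  have k1 := key i hmi hin.le
  have k2 := key (i + 1) (by omega) (by omega)
  rw [h.succ, h.succ] at k2
  linarith

theorem ite_eq_ite (h : MaxSol U S N ω) {t m n : ℤ} (hm : S (t - 1) m - S (t + 1) m = ω)
    (hn : S (t - 1) n - S (t + 1) n = ω) (hp : phase S N ω t m = phase S N ω t n) (i : ℤ) :
    (if i < m then U (t + 1) i else U (t - 1) i) = if i < n then U (t + 1) i else U (t - 1) i := by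
  by_cases h1 : i < m <;> by_cases h2 : i < n <;> simp only [h1, h2, if_true, if_false]
  · exact h.eq_of_between hn hp.symm (not_lt.mp h2) h1
  · exact (h.eq_of_between hm hp (not_lt.mp h1) h2).symm

/-- Between consecutive split points, the fields at the two times add up to `κ_max`. -/
theorem sum_eq_kappa_between (h : MaxSol U S N ω) {t m n : ℤ}
    (hm : S (t - 1) m - S (t + 1) m = ω)
    (hp : phase S N ω t m = phase S N ω (t + 1) n) {i : ℤ}
    (hi : m ≤ i ∧ i < n ∨ n ≤ i ∧ i < m) : U t i + U (t + 1) i = min 1 ω := by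
  have e := phase_time_succ S N ω t m
  have hs := h.phase_succ (t + 1) i
  rw [add_sub_cancel_right] at hs
  have hle := h.sum_le_kappa t i
  rcases hi with ⟨h1, h2⟩ | ⟨h1, h2⟩
  · have a1 := h.phase_mono (t + 1) h1
    have a2 := h.phase_mono (t + 1) (show i + 1 ≤ n by omega)
    linarith
  · have a1 := h.phase_mono (t + 1) h1
    have a2 := h.phase_mono (t + 1) (show i + 1 ≤ m by omega)
    linarith

/-- The undressed cumulative sum, with split point `m`. -/
def undressSum (S : ℤ → ℤ → ℝ) (ω : ℝ) (t m i : ℤ) : ℝ :=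
  if i < m then S (t + 1) i else S (t - 1) i - ω

theorem undressSum_succ (h : MaxSol U S N ω) {t m : ℤ} (hm : S (t - 1) m - S (t + 1) m = ω)
    (i : ℤ) : undressSum S ω t m (i + 1) =
      undressSum S ω t m i + if i < m then U (t + 1) i else U (t - 1) i := by
  have e1 := h.succ (t - 1) i
  have e2 := h.succ (t + 1) i
  simp only [undressSum]
  rcases lt_trichotomy (i + 1) m with hi | hi | hi
  · rw [if_pos hi, if_pos (by omega), if_pos (by omega), e2]
  · subst hi
    rw [if_neg (by omega), if_pos (by omega), if_pos (by omega)]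
    linarith
  · rw [if_neg (by omega), if_neg (by omega), if_neg (by omega), e1]; ring

/-- The udKdV equation for the undressed field, for consecutive split points `r` and `r + 1`. -/
theorem undress_eq (h : MaxSol U S N ω) {t r : ℤ} (hr : S (t - 1) r - S (t + 1) r = ω) (i : ℤ) :
    (if i < r + 1 then U (t + 2) i else U t i) =
      min (1 - if i < r then U (t + 1) i else U (t - 1) i)
        (undressSum S ω t r i - undressSum S ω (t + 1) (r + 1) i) := by
  have e1 := h.le_one (t + 1) i
  have e2 := h.le_carrier (t + 1) i
  have e3 := h.eq_or (t + 1) i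
  have e4 := h.density_le (t + 1) i
  rw [add_assoc, one_add_one_eq_two] at e1 e2 e3 e4
  rw [add_sub_cancel_right] at e4
  obtain ⟨f1, f2, f3⟩ := h.pred t i
  rw [min_eq_iff_le_or, undressSum, undressSum, add_assoc, one_add_one_eq_two,
    add_sub_cancel_right]
  rcases lt_trichotomy i r with hi | rfl | hi
  · rw [if_pos (by omega), if_pos (by omega), if_pos (by omega), if_pos (by omega)]
    refine ⟨by linarith, e2, e3.imp (fun e => by linarith) id⟩
  · rw [if_pos (by omega), if_neg (by omega), if_neg (by omega), if_pos (by omega)]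
    have g1 := h.sum_eq_kappa hr
    have g2 := h.sum_le_kappa (t + 1) i
    rw [add_assoc, one_add_one_eq_two] at g2
    have g3 := h.sum_le_kappa (t - 1) i
    rw [sub_add_cancel] at g3
    refine ⟨by linarith [min_le_left 1 ω], by linarith, ?_⟩
    rcases e3 with e3 | e3
    · rcases f3 with f3 | f3
      · left; linarith [min_le_left 1 ω]
      · right; linarith [min_le_left 1 ω]
    · right; linarith
  · rw [if_neg (by omega), if_neg (by omega), if_neg (by omega), if_neg (by omega)]
    refine ⟨by linarith, by linarith, f3.imp (fun e => by linarith) (fun e => by linarith)⟩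

end MaxSol

/-! ### Translation to the definitions of the statement -/

theorem X_eq {U : ℤ → ℤ → ℝ} (hF : FinitelySupported U) (hK : IsUdKdV U) (t i : ℤ) :
    X U t i = leftSum (U (t - 1)) i - leftSum (U (t + 1)) i := by
  have hf := support_sub_finite (hF (t + 1)) (hF (t - 1))
  have e : ∑ᶠ j, (U (t + 1) j - U (t - 1) j) = 0 := by
    rw [finsum_sub_distrib (hF (t + 1)) (hF (t - 1)), mass_conserved hF hK,
      mass_conserved hF hK (t - 1), sub_self]
  have e' : leftSum (fun j => U (t + 1) j - U (t - 1) j) i =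
      leftSum (U (t + 1)) i - leftSum (U (t - 1)) i := leftSum_sub (hF _) (hF _) i
  rw [X, rightSum_eq hf, e, e']; ring

theorem exists_maxSol {U : ℤ → ℤ → ℝ} (hF : FinitelySupported U) (hK : IsUdKdV U)
    (hpos : ∃ t, 0 < localMax U t) :
    ∃ ω, MaxSol U (fun t => leftSum (U t)) (∑ᶠ j, U 0 j) ω ∧ (∀ t, omegaMax U t = ω) ∧
      ∀ t, (maxSites U t).Nonempty := by
  have h := localSol_of_isUdKdV hF hK
  have hmax : ∀ t, ∃ m, omegaMax U t = X U t m ∧ ∀ i, X U t i ≤ omegaMax U t := by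
    intro t
    obtain ⟨m, -, hm⟩ := h.exists_max_density t
    have hm' : ∀ i, X U t i ≤ X U t m := fun i => by
      rw [X_eq hF hK, X_eq hF hK]; exact hm i
    have e : omegaMax U t = X U t m :=
      le_antisymm (ciSup_le hm') (le_ciSup (f := X U t) ⟨_, Set.forall_mem_range.mpr hm'⟩ m)
    exact ⟨m, e, fun i => (hm' i).trans e.ge⟩
  have hbound : ∀ s t, omegaMax U t ≤ omegaMax U s := by
    intro s t
    obtain ⟨m, hm, -⟩ := hmax t
    rw [hm, X_eq hF hK]
    refine h.density_bound (t₀ := s) (fun i => ?_) t m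
    obtain ⟨-, -, hs⟩ := hmax s
    have := hs i
    rwa [X_eq hF hK] at this
  have hconst : ∀ t, omegaMax U t = omegaMax U 0 := fun t =>
    le_antisymm (hbound 0 t) (hbound t 0)
  have hle : ∀ t i, X U t i ≤ omegaMax U 0 := fun t i => by
    obtain ⟨-, -, hs⟩ := hmax t
    exact (hs i).trans (hbound 0 t)
  refine ⟨omegaMax U 0, ⟨h, ?_, fun t i => ?_⟩, hconst, fun t => ?_⟩
  · obtain ⟨t, ht⟩ := hpos
    obtain ⟨i, hi⟩ := exists_lt_of_lt_ciSup ht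
    have e := hle t (i + 1)
    rw [X_eq hF hK] at e
    have e1 := h.le_carrier_succ t i
    have e2 := (h.pred t (i + 1)).2.1
    linarith
  · rw [← X_eq hF hK]; exact hle t i
  · obtain ⟨m, hm, -⟩ := hmax t
    exact ⟨m, hm.symm⟩

/-- The data of a soliton-containing solution in terms of its maximal mass `ω`. -/
structure Setting (U : ℤ → ℤ → ℝ) (ω : ℝ) : Prop where
  fin : FinitelySupported U
  kdv : IsUdKdV U
  sol : MaxSol U (fun t => leftSum (U t)) (∑ᶠ j, U 0 j) ω
  omega : ∀ t, omegaMax U t = ω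

namespace Setting

variable {U : ℤ → ℤ → ℝ} {ω : ℝ}

theorem mem_maxSites_iff (h : Setting U ω) {t m : ℤ} :
    m ∈ maxSites U t ↔ leftSum (U (t - 1)) m - leftSum (U (t + 1)) m = ω := by
  rw [maxSites, Set.mem_ofPred_eq, X_eq h.fin h.kdv, h.omega]

theorem kappa_mul_varphiMax (h : Setting U ω) (t m : ℤ) :
    min 1 ω * varphiMax U t m =
      min 1 ω * m + ∑ᶠ j, U 0 j - leftSum (U (t - 1)) m - leftSum (U t) m := by
  have hk := h.sol.kappa_pos.ne'
  have e : ∑ᶠ j ∈ Set.Iio m, U t j = leftSum (U t) m := rfl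
  rw [varphiMax, phiMax, kappaMax, h.omega, rightSum_eq (h.fin (t - 1)),
    mass_conserved h.fin h.kdv, e]
  field_simp
  ring

theorem kappa_mul_phiMax (h : Setting U ω) (t m : ℤ) :
    min 1 ω * phiMax U t m = phase (fun t => leftSum (U t)) (∑ᶠ j, U 0 j) ω t m := by
  have e := h.kappa_mul_varphiMax t m
  have e' : min 1 ω * cMax U t = ω := by rw [cMax, h.omega, min_mul_max, one_mul]
  rw [varphiMax, mul_add, ← mul_assoc, e'] at e
  rw [phase]
  linarith

theorem isSplitFamily_iff (h : Setting U ω) {m : ℤ → ℤ} :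
    IsSplitFamily U m ↔
      (∀ t, leftSum (U (t - 1)) (m t) - leftSum (U (t + 1)) (m t) = ω) ∧
      ∀ s t, phase (fun t => leftSum (U t)) (∑ᶠ j, U 0 j) ω s (m s) =
        phase (fun t => leftSum (U t)) (∑ᶠ j, U 0 j) ω t (m t) := by
  simp only [IsSplitFamily, h.mem_maxSites_iff, ← h.kappa_mul_phiMax,
    mul_right_inj' h.sol.kappa_pos.ne']

theorem boundState_of_le (h : Setting U ω) (m : ℤ → ℤ) {t i : ℤ} (hi : i ≤ m t) :
    boundState U m t i =
      min 1 ω * (i - varphiMax U t (m t)) + ∑ᶠ j, U 0 j - leftSum (U t) i := by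
  rcases hi.lt_or_eq with hi | hi
  · rw [boundState, if_pos hi, kappaMax, h.omega, rightSum_eq (h.fin t),
      mass_conserved h.fin h.kdv]
    ring
  · have e : ∑ᶠ j ∈ Set.Iio i, U (t - 1) j = leftSum (U (t - 1)) i := rfl
    rw [boundState, if_neg (by omega), mul_sub, h.kappa_mul_varphiMax, ← hi, e]
    ring

theorem boundState_of_ge (m : ℤ → ℤ) {t i : ℤ} (hi : m t ≤ i) :
    boundState U m t i = leftSum (U (t - 1)) i := by
  rw [boundState, if_neg (by omega)]; rfl

theorem boundState_eq_min (h : Setting U ω) (m : ℤ → ℤ) (t i : ℤ) :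
    boundState U m t i = min
      (min 1 ω * (i - varphiMax U t (m t)) + ∑ᶠ j, U 0 j - leftSum (U t) i)
      (leftSum (U (t - 1)) i) := by
  have e := h.kappa_mul_varphiMax t (m t)
  rcases le_total i (m t) with hi | hi
  · have := h.sol.phase_mono t hi
    simp only [phase] at this
    rw [h.boundState_of_le m hi]
    refine (min_eq_left ?_).symm
    linarith
  · have := h.sol.phase_mono t hi
    simp only [phase] at this
    rw [boundState_of_ge m hi]
    refine (min_eq_right ?_).symm
    linarith

theorem boundState_succ_sub (h : Setting U ω) (m : ℤ → ℤ) (t i : ℤ) :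
    boundState U m t (i + 1) - boundState U m t i =
      if i < m t then min 1 ω - U t i else U (t - 1) i := by
  split_ifs with hi
  · rw [h.boundState_of_le m (show i + 1 ≤ m t by omega), h.boundState_of_le m hi.le,
      leftSum_succ (h.fin t)]
    push_cast; ring
  · rw [boundState_of_ge m (show m t ≤ i + 1 by omega), boundState_of_ge m (not_lt.mp hi),
      leftSum_succ (h.fin (t - 1))]
    ring

theorem undress_apply (h : Setting U ω) {m : ℤ → ℤ} (hm : IsSplitFamily U m) (t i : ℤ) :
    undress U m t i = if i < m t then U (t + 1) i else U (t - 1) i := by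
  obtain ⟨h1, h2⟩ := h.isSplitFamily_iff.mp hm
  have key := h.sol.sum_eq_kappa_between (i := i) (h1 t) (h2 t (t + 1))
  rw [undress, darboux, h.boundState_succ_sub, h.boundState_succ_sub, add_sub_cancel_right]
  by_cases a : i < m t <;> by_cases b : i < m (t + 1) <;> simp only [a, b, if_true, if_false]
  · ring
  · linarith [key (Or.inr ⟨not_lt.mp b, a⟩)]
  · linarith [key (Or.inl ⟨not_lt.mp a, b⟩)]
  · ring

theorem finitelySupported_undress (h : Setting U ω) {m : ℤ → ℤ} (hm : IsSplitFamily U m) :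
    FinitelySupported (undress U m) := by
  intro t
  refine ((h.fin (t + 1)).union (h.fin (t - 1))).subset fun i hi => ?_
  rw [Function.mem_support, h.undress_apply hm] at hi
  split_ifs at hi
  · exact Or.inl hi
  · exact Or.inr hi

theorem leftSum_undress (h : Setting U ω) {m : ℤ → ℤ} (hm : IsSplitFamily U m) {t n : ℤ}
    (hn : leftSum (U (t - 1)) n - leftSum (U (t + 1)) n = ω)
    (hu : ∀ i, undress U m t i = if i < n then U (t + 1) i else U (t - 1) i) (i : ℤ) :
    leftSum (undress U m t) i = MaxSol.undressSum (fun t => leftSum (U t)) ω t n i := by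
  obtain ⟨a, ha⟩ := leftSum_atBot (h.fin (t + 1))
  refine leftSum_eq_of_increments (a := min a (n - 1)) (h.finitelySupported_undress hm t)
    (fun i => ?_) (fun i hi => ?_) i
  · rw [hu]; exact h.sol.undressSum_succ hn i
  · rw [le_min_iff] at hi
    rw [MaxSol.undressSum, if_pos (by omega)]
    exact ha i hi.1

theorem isUdKdV_undress (h : Setting U ω) {m : ℤ → ℤ} (hm : IsSplitFamily U m) :
    IsUdKdV (undress U m) := by
  obtain ⟨h1, h2⟩ := h.isSplitFamily_iff.mp hm
  rw [isUdKdV_iff (h.finitelySupported_undress hm)]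
  intro t i
  obtain ⟨r, hr1, hr2, hr3, hr4⟩ := h.sol.exists_succ_site (h1 t)
  have hr3' : leftSum (U (t + 1 - 1)) (r + 1) - leftSum (U (t + 1 + 1)) (r + 1) = ω := by
    rwa [add_sub_cancel_right, add_assoc, one_add_one_eq_two]
  have u1 : ∀ i, undress U m t i = if i < r then U (t + 1) i else U (t - 1) i := fun i => by
    rw [h.undress_apply hm]
    exact h.sol.ite_eq_ite (h1 t) hr1 hr2.symm i
  have u2 : ∀ i, undress U m (t + 1) i =
      if i < r + 1 then U (t + 1 + 1) i else U (t + 1 - 1) i := fun i => by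
    rw [h.undress_apply hm]
    exact h.sol.ite_eq_ite (h1 (t + 1)) hr3' ((h2 (t + 1) t).trans hr4.symm) i
  rw [h.leftSum_undress hm hr1 u1, h.leftSum_undress hm hr3' u2, u1, u2, add_sub_cancel_right,
    add_assoc, one_add_one_eq_two]
  exact h.sol.undress_eq hr1 i

theorem exists_isSplitFamily (h : Setting U ω) {t₀ m₀ : ℤ} (hm : m₀ ∈ maxSites U t₀) :
    ∃ m, m t₀ = m₀ ∧ IsSplitFamily U m := by
  obtain ⟨m, h1, h2⟩ := h.sol.exists_family (h.mem_maxSites_iff.mp hm)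
  exact ⟨m, h1, h.isSplitFamily_iff.mpr
    ⟨fun t => (h2 t).1, fun s t => (h2 s).2.trans (h2 t).2.symm⟩⟩

end Setting

theorem exists_setting {U : ℤ → ℤ → ℝ} (hF : FinitelySupported U) (hK : IsUdKdV U)
    (hpos : ∃ t, 0 < localMax U t) : ∃ ω, Setting U ω := by
  obtain ⟨ω, h, hω, -⟩ := exists_maxSol hF hK hpos
  exact ⟨ω, hF, hK, h, hω⟩

/-! ### The bilinear equation -/

/-- The second time difference of a `T`-function. -/
def secondDiff (T : ℤ → ℤ → ℝ) (t i : ℤ) : ℝ := T (t + 1) i - 2 * T t i + T (t - 1) i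

theorem secondDiff_succ (T : ℤ → ℤ → ℝ) (t i : ℤ) :
    secondDiff T t (i + 1) - secondDiff T t i = potential T (t - 1) i - potential T t i := by
  simp only [secondDiff, potential, sub_add_cancel]; ring

theorem isBilinear_iff (T : ℤ → ℤ → ℝ) :
    IsBilinear T ↔ ∀ t i, potential T t i =
      min (1 - potential T (t - 1) i) (secondDiff T t i) := by
  refine forall₂_congr fun t i => ?_
  rw [min_eq_iff_le_or, ← neg_inj, ← min_neg_neg, min_eq_iff_le_or]
  simp only [secondDiff, potential, sub_add_cancel]
  constructor
  · rintro ⟨h1, h2, h | h⟩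
    · exact ⟨by linarith, by linarith, Or.inr (by linarith)⟩
    · exact ⟨by linarith, by linarith, Or.inl (by linarith)⟩
  · rintro ⟨h1, h2, h | h⟩
    · exact ⟨by linarith, by linarith, Or.inr (by linarith)⟩
    · exact ⟨by linarith, by linarith, Or.inl (by linarith)⟩

theorem secondDiff_eq {T : ℤ → ℤ → ℝ} (hF : FinitelySupported (potential T)) {t a : ℤ}
    (ha : ∀ i ≤ a, secondDiff T t i = 0) (i : ℤ) : secondDiff T t i =
      ∑ᶠ j ∈ Set.Iio i, (potential T (t - 1) j - potential T t j) :=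
  (leftSum_eq_of_increments (support_sub_finite (hF (t - 1)) (hF t))
    (fun i => by linarith [secondDiff_succ T t i]) ha i).symm

theorem isUdKdV_potential {T : ℤ → ℤ → ℝ} (hF : FinitelySupported (potential T))
    (hB : IsBilinear T) : IsUdKdV (potential T) := by
  rw [isBilinear_iff] at hB
  intro t i
  obtain ⟨a, ha⟩ := eventually_atBot_eq_zero (hF t)
  obtain ⟨b, hb⟩ := eventually_atBot_eq_zero (hF (t + 1))
  have h0 : ∀ i ≤ min a b - 1, secondDiff T (t + 1) i = 0 := fun i hi => by
    have e := hB (t + 1) i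
    rw [add_sub_cancel_right, ha i (by omega), hb i (by omega), min_eq_iff_le_or] at e
    rcases e with ⟨-, -, e | e⟩ <;> linarith
  rw [hB (t + 1) i, secondDiff_eq hF h0, add_sub_cancel_right]

theorem isBilinear_of_isUdKdV {T : ℤ → ℤ → ℝ} (hF : FinitelySupported (potential T))
    (hK : IsUdKdV (potential T)) (h0 : ∀ t, ∃ a, ∀ i ≤ a, secondDiff T t i = 0) :
    IsBilinear T := by
  rw [isBilinear_iff]
  intro t i
  obtain ⟨a, ha⟩ := h0 t
  have e := hK (t - 1) i
  rw [sub_add_cancel] at e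
  rw [e, secondDiff_eq hF ha]

theorem IsBilinear.gaugeEquiv {T T' : ℤ → ℤ → ℝ} (hB : IsBilinear T) (hG : GaugeEquiv T T') :
    IsBilinear T' := by
  obtain ⟨α, β, γ, h⟩ := hG
  intro t i
  have e := hB t i
  have e' : T' (t + 1) (i + 1) + T' (t - 1) i =
      (T (t + 1) (i + 1) + T (t - 1) i) + (2 * α * i + α + 2 * β * t + 2 * γ) := by
    rw [h, h]; push_cast; ring
  rw [e', e, ← max_add_add_right, h, h, h, h]
  push_cast
  congr 1 <;> ring

theorem GaugeEquiv.symm {T T' : ℤ → ℤ → ℝ} (h : GaugeEquiv T T') : GaugeEquiv T' T := by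
  obtain ⟨α, β, γ, h⟩ := h
  exact ⟨-α, -β, -γ, fun t i => by rw [h]; ring⟩

theorem potential_add (T Θ : ℤ → ℤ → ℝ) :
    potential (T + Θ) = darboux (potential T) Θ := by
  funext t i
  simp only [potential, darboux, Pi.add_apply]; ring

namespace Setting

variable {T : ℤ → ℤ → ℝ} {ω : ℝ}

theorem varphiMax_eq {U : ℤ → ℤ → ℝ} (h : Setting U ω) {m : ℤ → ℤ} (hm : IsSplitFamily U m)
    (t : ℤ) : varphiMax U t (m t) = phiMax U 0 (m 0) + max 1 ω * t := by
  rw [varphiMax, hm.2 t 0, cMax, h.omega]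

theorem isBilinear_add (h : Setting (potential T) ω) {m : ℤ → ℤ}
    (hm : IsSplitFamily (potential T) m) (hB : IsBilinear T) :
    IsBilinear (T + boundState (potential T) m) := by
  have hF := h.finitelySupported_undress hm
  have hK := h.isUdKdV_undress hm
  rw [undress, ← potential_add] at hF hK
  refine isBilinear_of_isUdKdV hF hK fun t => ?_
  obtain ⟨a, ha⟩ := eventually_atBot_eq_zero (h.fin t)
  obtain ⟨b, hb⟩ := eventually_atBot_eq_zero (h.fin (t - 1))
  obtain ⟨c, hc⟩ := leftSum_atBot (h.fin (t + 1))
  obtain ⟨d, hd⟩ := leftSum_atBot (h.fin t)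
  obtain ⟨e, he⟩ := leftSum_atBot (h.fin (t - 1))
  obtain ⟨n, hn⟩ : ∃ n, n < a ∧ n < b ∧ n < c ∧ n < d ∧ n < e ∧ n < m (t + 1) ∧ n < m t ∧
      n < m (t - 1) :=
    ⟨min (min (min a b) (min c d)) (min (min e (m (t + 1))) (min (m t) (m (t - 1)))) - 1,
      by omega⟩
  refine ⟨n, fun i hi => ?_⟩
  have z : secondDiff T t i = 0 := by
    have z := (isBilinear_iff T).mp hB t i
    rw [ha i (by omega), hb i (by omega), min_eq_iff_le_or] at z
    rcases z with ⟨-, -, z | z⟩ <;> linarith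
  have y : secondDiff (boundState (potential T) m) t i = 0 := by
    rw [secondDiff, h.boundState_of_le m (show i ≤ m (t + 1) by omega),
      h.boundState_of_le m (show i ≤ m t by omega),
      h.boundState_of_le m (show i ≤ m (t - 1) by omega), hc i (by omega), hd i (by omega),
      he i (by omega), h.varphiMax_eq hm, h.varphiMax_eq hm, h.varphiMax_eq hm]
    push_cast; ring
  simp only [secondDiff, Pi.add_apply] at z y ⊢
  linarith

theorem gaugeEquiv_undressT (h : Setting (potential T) ω) {m : ℤ → ℤ}
    (hm : IsSplitFamily (potential T) m) (hN : IsNormalised T) :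
    GaugeEquiv (undressT T m) (T + boundState (potential T) m) := by
  have hZ : ∀ t i, leftSum (potential T t) i =
      T t i - T (t + 1) i + 1 / 2 * ∑ᶠ j, potential T 0 j := by
    intro t i
    obtain ⟨a, ha⟩ := eventually_atBot.mp (hN t)
    rw [← mass_conserved h.fin h.kdv t]
    refine leftSum_eq_of_increments
      (P := fun i => T t i - T (t + 1) i + 1 / 2 * ∑ᶠ j, potential T t j) (a := a) (h.fin t)
      (fun i => ?_) (fun i hi => ?_) i
    · simp only [potential]; ring
    · simp only [ha i hi]; ring
  refine ⟨1 / 2 * min 1 ω, -(1 / 2) * min 1 ω * max 1 ω,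
    -(1 / 2) * min 1 ω * phiMax (potential T) 0 (m 0) + 1 / 2 * ∑ᶠ j, potential T 0 j,
    fun t i => ?_⟩
  have e := hZ (t - 1) i
  rw [sub_add_cancel] at e
  rw [Pi.add_apply, Pi.add_apply, h.boundState_eq_min, hZ t i, e, undressT, kappaMax, h.omega,
    h.varphiMax_eq hm, ← min_add_add_left, add_assoc, add_assoc, ← min_add_add_right]
  congr 1 <;> ring

end Setting

end UdKdV

end

open UdKdV in
theorem mainTheorem7 :
    (∀ U : ℤ → ℤ → ℝ, FinitelySupported U → IsUdKdV U → (∃ t, 0 < localMax U t) →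
      (∀ t₀, (maxSites U t₀).Nonempty) ∧
      (∀ t₀, ∀ m₀ ∈ maxSites U t₀, ∃ m, m t₀ = m₀ ∧ IsSplitFamily U m) ∧
      (∀ m, IsSplitFamily U m →
        (∀ t i, undress U m t i = if i < m t then U (t + 1) i else U (t - 1) i) ∧
        FinitelySupported (undress U m) ∧
        IsUdKdV (undress U m))) ∧
    (∀ T : ℤ → ℤ → ℝ, IsBilinear T → FinitelySupported (potential T) →
      (∃ t, 0 < localMax (potential T) t) →
      IsUdKdV (potential T) ∧
      (∀ m, IsSplitFamily (potential T) m →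
        IsBilinear (T + boundState (potential T) m) ∧
        potential (T + boundState (potential T) m) = undress (potential T) m ∧
        (IsNormalised T →
          GaugeEquiv (undressT T m) (T + boundState (potential T) m) ∧
          ∀ T', GaugeEquiv (undressT T m) T' → IsBilinear T'))) := by
  refine ⟨fun U hF hK hpos => ?_, fun T hB hF hpos => ?_⟩
  · obtain ⟨ω, h⟩ := exists_setting hF hK hpos
    obtain ⟨-, -, -, hne⟩ := exists_maxSol hF hK hpos
    exact ⟨hne, fun t₀ m₀ hm => h.exists_isSplitFamily hm, fun m hm =>
      ⟨h.undress_apply hm, h.finitelySupported_undress hm, h.isUdKdV_undress hm⟩⟩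
  · have hK := isUdKdV_potential hF hB
    obtain ⟨ω, h⟩ := exists_setting hF hK hpos
    refine ⟨hK, fun m hm => ?_⟩
    have hB' := h.isBilinear_add hm hB
    refine ⟨hB', potential_add T _, fun hN => ?_⟩
    have hG := h.gaugeEquiv_undressT hm hN
    exact ⟨hG, fun T' hT' => (hB'.gaugeEquiv hG.symm).gaugeEquiv hT'⟩
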